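/- Words and languages. For a non-empty finite set $A$ let $A^+$ and $A^*$ be the free semigroup and the free monoid on $A$, let $\$\notin A$ be a padding symbol, and put $A(2,\$)=((A\cup\{\$\})\times(A\cup\{\$\}))\setminus\{(\$,\$)\}$. Let $\delta_A:A^*\times A^*\to A(2,\$)^*$ be the map that reads two words in parallel, letter by letter, the shorter word being padded at its end with $\$$ to the length of the longer one. A semigroup $S$ is automatic if there are a non-empty finite set $A$, a map $\psi:A\to S$ whose extension to a homomorphism $\psi:A^+\to S$ is surjective, and a regular language $L\subseteq A^+$ with $L\psi=S$ such that $$L_= =\{(\alpha,\beta)\delta_A:\alpha,\beta\in L,\ \alpha\psi=\beta\psi\}\quad\text{and}\quad L_a=\{(\alpha,\beta)\delta_A:\alpha,\beta\in L,\ (\alpha a)\psi=\beta\psi\}\ (a\in A)$$ are regular languages over $A(2,\$)$. A monoid is automatic if it is automatic as a semigroup. Wreath products. Let $S$ and $T$ be semigroups and let $e\in S$ be a distinguished idempotent. The unrestricted wreath product of $S$ and $T$ is the set $S^T\times T$ with the multiplication $(f,t)(g,u)=(f\cdot{}^{t}g,\,tu)$, where $S^T$ is multiplied componentwise and $({}^{t}g)(x)=g(xt)$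 for $x\in T$. The wreath product $S\wr T$ (with respect to $e$) is the subsemigroup of the unrestricted wreath product generated by the pairs $(f,t)$ for which $\{x\in T: f(x)\neq e\}$ is finite. Corollary. Let $S$ be an automatic monoid and let $T$ be a finite monoid. Then, for every distinguished idempotent $e\in S$ (for example $e=1_S$), the wreath product $S\wr T$ with respect to $e$ is automatic. -/

import Mathlib

/-! ### Automatic semigroups -/

/-- The padded alphabet `A(2,$) = ((A ∪ {$}) × (A ∪ {$})) \ {($,$)}`, where `none` plays the role of
the padding symbol `$`. -/
abbrev PaddedAlphabet (A : Type*) : Type _ :=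
  {p : Option A × Option A // p ≠ (none, none)}

/-- The map `δ_A : A* × A* → A(2,$)*` reading two words in parallel, the shorter one being padded
with `$` at its end. -/
def padPair {A : Type*} : List A → List A → List (PaddedAlphabet A)
  | [], v => v.map fun b => ⟨(none, some b), by simp⟩
  | a :: u, [] => (a :: u).map fun a => ⟨(some a, none), by simp⟩
  | a :: u, b :: v => ⟨(some a, some b), by simp⟩ :: padPair u v

/-- The finite sequence of letters of an element of the free semigroup `A⁺`. -/
def FreeSemigroup.toWord {A : Type*} (w : FreeSemigroup A) : List A :=
  w.head :: w.tail

/-- The language `{(α, β) : α, β ∈ L, α R β} δ_A` over `A(2,$)`. -/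
def paddedRel {A : Type*} (L : Set (FreeSemigroup A))
    (R : FreeSemigroup A → FreeSemigroup A → Prop) : Language (PaddedAlphabet A) :=
  {w | ∃ α ∈ L, ∃ β ∈ L, R α β ∧ w = padPair α.toWord β.toWord}

/-- `(A, L)` is an automatic structure for the semigroup `S` with respect to `ψ : A → S`; here
`FreeSemigroup.lift ψ : A⁺ →ₙ* S` is the extension of `ψ` to a homomorphism. -/
structure IsAutomaticStructure {S : Type*} [Semigroup S] {A : Type*} (ψ : A → S)
    (L : Set (FreeSemigroup A)) : Prop where
  generates : Function.Surjective (FreeSemigroup.lift ψ)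
  regular : Language.IsRegular (FreeSemigroup.toWord '' L : Language A)
  image_eq : FreeSemigroup.lift ψ '' L = Set.univ
  regular_eq : (paddedRel L fun α β =>
    FreeSemigroup.lift ψ α = FreeSemigroup.lift ψ β).IsRegular
  regular_mul : ∀ a : A, (paddedRel L fun α β =>
    FreeSemigroup.lift ψ (α * FreeSemigroup.of a) = FreeSemigroup.lift ψ β).IsRegular

/-- A semigroup is automatic if it has an automatic structure, over some alphabet, i.e. over some
non-empty finite set. -/
def IsAutomatic (S : Type*) [Semigroup S] : Prop :=
  ∃ (A : Type) (_ : Finite A) (_ : Nonempty A) (ψ : A → S) (L : Set (FreeSemigroup A)),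
    IsAutomaticStructure ψ L

/-! ### Wreath products -/

/-- The underlying set `S^T × T` of the unrestricted wreath product of `S` and `T`. -/
@[ext]
structure UnrestrictedWreathProduct (S T : Type*) where
  base : T → S
  top : T

/-- The multiplication `(f, t)(g, u) = (f · ᵗg, t u)`, where `ᵗg` is the map `x ↦ g (x t)`. -/
instance UnrestrictedWreathProduct.instSemigroup {S T : Type*} [Semigroup S] [Semigroup T] :
    Semigroup (UnrestrictedWreathProduct S T) where
  mul p q := ⟨fun x => p.base x * q.base (x * p.top), p.top * q.top⟩
  mul_assoc p q r := by
    apply UnrestrictedWreathProduct.ext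
    · funext x
      change p.base x * q.base (x * p.top) * r.base (x * (p.top * q.top)) =
        p.base x * (q.base (x * p.top) * r.base (x * p.top * q.top))
      rw [mul_assoc, mul_assoc x]
    · exact mul_assoc p.top q.top r.top

/-- The (restricted) wreath product of `S` and `T` with respect to a distinguished idempotent `e` of
`S`: the subsemigroup of the unrestricted wreath product generated by the pairs `(f, t)` such
that the support `{x | f x ≠ e}` of `f` is finite. -/
def wreathProduct {S : Type*} (e : S) (T : Type*) [Semigroup S] [Semigroup T] :
    Subsemigroup (UnrestrictedWreathProduct S T) :=
  Subsemigroup.closure {p | {x : T | p.base x ≠ e}.Finite}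

/-! ### Closure properties of regular languages -/

namespace Language

variable {α β : Type*}

/-! As `T` is finite, all supports are finite and the wreath product is all of `S^T × T`. Take the
alphabet `(A ∪ {1})^T × T` and represent `(f, t)` by words whose entries in `T` are `1` except for a
final `t`, and whose component at each `x` is a word of `L` for `f x`, filled up at the end with the
letter `1`. The shifts before the last letter are then trivial, so such a word evaluates
componentwise (`lift_wreathLetter`).

Equality is thus tested in each component. Since `(f, t)(g, s) = (f · ᵗg, t s)`, right
multiplication by a generator multiplies component `x` by the letter `g (x t)`, which depends only
on `x` and `t`. For fixed `t` each relation is a finite intersection of preimages of regular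
relations for `S`, and the union over `t` is finite (`isRegular_paddedRel`). The components have
different lengths, so the languages for `S` must first be closed under appending padding
(`IsRegular.padded`). -/

theorem IsRegular.of_forall_mem_iff {L M : Language α} (h : L.IsRegular)
    (hLM : ∀ w, w ∈ M ↔ w ∈ L) : M.IsRegular := by
  rwa [Language.ext hLM]

/-- Regular languages are closed under arbitrary Boolean combinations of finitely many of them. -/
theorem IsRegular.finite_combination {ι : Type*} [Finite ι] {L : ι → Language α}
    (h : ∀ i, (L i).IsRegular) (Q : (ι → Prop) → Prop) :
    Language.IsRegular ({w | Q fun i => w ∈ L i} : Language α) := by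
  classical
  have := Fintype.ofFinite ι
  choose σ hσ M hM using h
  refine isRegular_iff.2 ⟨∀ i, σ i, inferInstance, ⟨fun s a i => (M i).step (s i) a,
    fun i => (M i).start, {s | Q fun i => s i ∈ (M i).accept}⟩, ?_⟩
  have key : ∀ (w : List α) (s : ∀ i, σ i),
      DFA.evalFrom ⟨fun s a i => (M i).step (s i) a, fun i => (M i).start,
        {s | Q fun i => s i ∈ (M i).accept}⟩ s w = fun i => (M i).evalFrom (s i) w := by
    intro w
    induction w with
    | nil => intro s; rfl
    | cons a w ih => intro s; rw [DFA.evalFrom_cons, ih]; rfl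
  ext w
  rw [DFA.mem_accepts, DFA.eval, key]
  simp only [← hM]
  rfl

theorem IsRegular.exists {ι : Type*} [Finite ι] {L : ι → Language α}
    (h : ∀ i, (L i).IsRegular) : Language.IsRegular ({w | ∃ i, w ∈ L i} : Language α) :=
  IsRegular.finite_combination h fun p => ∃ i, p i

theorem IsRegular.forall {ι : Type*} [Finite ι] {L : ι → Language α}
    (h : ∀ i, (L i).IsRegular) : Language.IsRegular ({w | ∀ i, w ∈ L i} : Language α) :=
  IsRegular.finite_combination h fun p => ∀ i, p i

theorem IsRegular.preimage_map {L : Language β} (h : L.IsRegular) (f : α → β) :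
    Language.IsRegular ({w | w.map f ∈ L} : Language α) := by
  obtain ⟨σ, hσ, M, rfl⟩ := h
  exact ⟨σ, hσ, M.comap f, M.accepts_comap f⟩

/-- The words obtained from those of `L` by rewriting them along `f` and appending copies of `d`. -/
def padded (f : α → β) (d : β) (L : Language α) : Language β :=
  {w | ∃ v ∈ L, ∃ k, w = v.map f ++ List.replicate k d}

/-- An automaton for `padded f d L` built from one for `L`; the Boolean component of a state tells
whether the padding has begun. -/
noncomputable def paddedDFA {σ : Type*} (f : α → β) (d : β) (M : DFA α σ) :
    DFA β (Option (σ × Bool)) := by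
  classical
  exact
  { step := fun s c => s.bind fun p =>
      if c = d then some (p.1, true)
      else if p.2 = true then none
      else if h : ∃ a, f a = c then some (M.step p.1 h.choose, false) else none
    start := some (M.start, false)
    accept := {s | ∃ p, s = some p ∧ p.1 ∈ M.accept} }

/-- Injectivity of `f` lets the automaton recover the original letter, and `d` lying outside its
range marks unambiguously where the padding begins. From then on the state is frozen, and any letter
other than `d` leads to the sink `none`. -/
theorem IsRegular.padded {f : α → β} (hf : Function.Injective f) {d : β} (hd : ∀ a, f a ≠ d)
    {L : Language α} (h : L.IsRegular) : (L.padded f d).IsRegular := by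
  obtain ⟨σ, hσ, M, rfl⟩ := h
  refine ⟨Option (σ × Bool), inferInstance, paddedDFA f d M, ?_⟩
  have dead : ∀ w, (paddedDFA f d M).evalFrom none w = none := by
    intro w
    induction w with
    | nil => rfl
    | cons c w ih => exact ih
  have pad : ∀ w s, (paddedDFA f d M).evalFrom (some (s, true)) w ∈ (paddedDFA f d M).accept ↔
      s ∈ M.accept ∧ ∃ k, w = List.replicate k d := by
    intro w
    induction w with
    | nil =>
      intro s
      simp only [DFA.evalFrom_nil]
      constructor
      · rintro ⟨p, hp, h⟩
        cases hp
        exact ⟨h, 0, rfl⟩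
      · rintro ⟨h, -⟩
        exact ⟨_, rfl, h⟩
    | cons c w ih =>
      intro s
      rw [DFA.evalFrom_cons]
      by_cases hc : c = d
      · have : (paddedDFA f d M).step (some (s, true)) c = some (s, true) := by
          simp [paddedDFA, hc]
        rw [this, ih, hc]
        refine and_congr_right fun _ => ⟨?_, ?_⟩
        · rintro ⟨k, rfl⟩
          exact ⟨k + 1, rfl⟩
        · rintro ⟨k, hk⟩
          cases k with
          | zero => simp at hk
          | succ k => exact ⟨k, by simpa [List.replicate_succ] using hk⟩
      · have : (paddedDFA f d M).step (some (s, true)) c = none := by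
          simp [paddedDFA, hc]
        rw [this, dead]
        constructor
        · rintro ⟨p, hp, -⟩
          cases hp
        · rintro ⟨-, k, hk⟩
          cases k with
          | zero => simp at hk
          | succ k => exact absurd (List.cons.inj hk).1 hc
  have main : ∀ w s, (paddedDFA f d M).evalFrom (some (s, false)) w ∈ (paddedDFA f d M).accept ↔
      ∃ v, M.evalFrom s v ∈ M.accept ∧ ∃ k, w = v.map f ++ List.replicate k d := by
    intro w
    induction w with
    | nil =>
      intro s
      simp only [DFA.evalFrom_nil]
      constructor
      · rintro ⟨p, hp, h⟩
        cases hp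
        exact ⟨[], h, 0, rfl⟩
      · rintro ⟨v, h, k, hk⟩
        obtain ⟨h1, -⟩ := List.append_eq_nil_iff.1 hk.symm
        rw [List.map_eq_nil_iff.1 h1] at h
        exact ⟨_, rfl, h⟩
    | cons c w ih =>
      intro s
      rw [DFA.evalFrom_cons]
      by_cases hc : c = d
      · have : (paddedDFA f d M).step (some (s, false)) c = some (s, true) := by
          simp [paddedDFA, hc]
        rw [this, pad, hc]
        constructor
        · rintro ⟨h, k, rfl⟩
          exact ⟨[], h, k + 1, rfl⟩
        · rintro ⟨v, h, k, hk⟩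
          cases v with
          | nil =>
            cases k with
            | zero => simp at hk
            | succ k => exact ⟨h, k, by simpa [List.replicate_succ] using hk⟩
          | cons a v => exact absurd (List.cons.inj hk).1.symm (hd a)
      · by_cases h : ∃ a, f a = c
        · obtain ⟨a, rfl⟩ := h
          have : (paddedDFA f d M).step (some (s, false)) (f a) = some (M.step s a, false) := by
            have h : ∃ b, f b = f a := ⟨a, rfl⟩
            have h' : h.choose = a := hf h.choose_spec
            simp only [paddedDFA, Option.bind_some, if_neg hc, dif_pos h, h']
            simp
          rw [this, ih]
          constructor
          · rintro ⟨v, h, k, rfl⟩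
            exact ⟨a :: v, h, k, rfl⟩
          · rintro ⟨v, h, k, hk⟩
            cases v with
            | nil =>
              cases k with
              | zero => simp at hk
              | succ k => exact absurd (List.cons.inj hk).1 hc
            | cons b v =>
              obtain ⟨hb, hk⟩ := List.cons.inj hk
              rw [← hf hb] at h
              exact ⟨v, h, k, hk⟩
        · have : (paddedDFA f d M).step (some (s, false)) c = none := by
            simp only [paddedDFA, Option.bind_some, if_neg hc, dif_neg h]
            simp
          rw [this, dead]
          constructor
          · rintro ⟨p, hp, -⟩
            cases hp
          · rintro ⟨v, -, k, hk⟩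
            cases v with
            | nil =>
              cases k with
              | zero => simp at hk
              | succ k => exact absurd (List.cons.inj hk).1 hc
            | cons b v => exact absurd ⟨b, (List.cons.inj hk).1.symm⟩ h
  ext w
  exact main w M.start

end Language

/-! ### Padded words and the map `padPair` -/

/-- `l` consists of the letters of `u` followed by padding symbols. -/
def IsPaddingOf {A : Type*} (l : List (Option A)) (u : List A) : Prop :=
  ∃ k, l = u.map some ++ List.replicate k none

namespace IsPaddingOf

variable {A B : Type*}

theorem nil_iff {u : List A} : IsPaddingOf [] u ↔ u = [] := by
  constructor
  · rintro ⟨k, hk⟩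
    exact List.map_eq_nil_iff.1 (List.append_eq_nil_iff.1 hk.symm).1
  · rintro rfl
    exact ⟨0, rfl⟩

theorem cons_nil_iff {c : Option A} {l : List (Option A)} :
    IsPaddingOf (c :: l) [] ↔ c = none ∧ IsPaddingOf l [] := by
  constructor
  · rintro ⟨k, hk⟩
    cases k with
    | zero => simp at hk
    | succ k =>
      obtain ⟨h1, h2⟩ := List.cons.inj hk
      exact ⟨h1, k, h2⟩
  · rintro ⟨rfl, k, rfl⟩
    exact ⟨k + 1, rfl⟩

theorem cons_cons_iff {c : Option A} {l : List (Option A)} {a : A} {u : List A} :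
    IsPaddingOf (c :: l) (a :: u) ↔ c = some a ∧ IsPaddingOf l u := by
  constructor
  · rintro ⟨k, hk⟩
    obtain ⟨h1, h2⟩ := List.cons.inj hk
    exact ⟨h1, k, h2⟩
  · rintro ⟨rfl, k, rfl⟩
    exact ⟨k, rfl⟩

theorem append_replicate_iff {l : List (Option A)} {k : ℕ} {u : List A} :
    IsPaddingOf (l ++ List.replicate k none) u ↔ IsPaddingOf l u := by
  induction l generalizing u with
  | nil =>
    rw [List.nil_append, nil_iff]
    cases u with
    | nil => exact iff_of_true ⟨k, rfl⟩ rfl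
    | cons a u =>
      refine iff_of_false ?_ (by simp)
      rintro ⟨j, hj⟩
      cases k with
      | zero => simp at hj
      | succ k => simpa using (List.cons.inj hj).1
  | cons c l ih =>
    cases u with
    | nil => rw [List.cons_append, cons_nil_iff, cons_nil_iff, ih]
    | cons a u => rw [List.cons_append, cons_cons_iff, cons_cons_iff, ih]

/-- Two layers of padding merge: outer padding symbols and letters that `p` sends to `none` both
become `none`, and extra trailing `none`s are harmless. -/
theorem map_bind_iff {l : List (Option B)} {u : List B} (h : IsPaddingOf l u) (p : B → Option A)
    {v : List A} : IsPaddingOf (l.map fun c => c.bind p) v ↔ IsPaddingOf (u.map p) v := by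
  obtain ⟨k, rfl⟩ := h
  rw [List.map_append, List.map_replicate, List.map_map]
  exact append_replicate_iff

theorem prod_eq {M : Type*} [Monoid M] {l : List (Option A)} {u : List A} (h : IsPaddingOf l u)
    (f : A → M) : (l.map fun c => c.elim 1 f).prod = (u.map f).prod := by
  obtain ⟨k, rfl⟩ := h
  simp [Function.comp_def]

theorem map_range_getElem? {u : List A} {n : ℕ} (h : u.length ≤ n) :
    IsPaddingOf ((List.range n).map fun i => u[i]?) u := by
  refine ⟨n - u.length, List.ext_getElem? fun i => ?_⟩
  by_cases h1 : i < n <;> by_cases h2 : i < u.length <;>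
    simp [List.getElem?_append, List.getElem?_replicate, h1, h2] <;> omega

end IsPaddingOf

theorem FreeSemigroup.exists_toWord_eq {A : Type*} {l : List A} (h : l ≠ []) :
    ∃ w : FreeSemigroup A, w.toWord = l := by
  cases l with
  | nil => exact absurd rfl h
  | cons a l => exact ⟨⟨a, l⟩, rfl⟩

theorem FreeSemigroup.lift_eq_prod {A M : Type*} [Monoid M] (f : A → M) (w : FreeSemigroup A) :
    FreeSemigroup.lift f w = (w.toWord.map f).prod := by
  induction w using FreeSemigroup.recOnMul with
  | ih1 a => rw [FreeSemigroup.lift_of]; simp [FreeSemigroup.toWord, FreeSemigroup.of]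
  | ih2 a w _ ih =>
    rw [map_mul, ih, FreeSemigroup.lift_of]
    simp [FreeSemigroup.toWord, FreeSemigroup.of]

/-- Allowing trailing `(none, none)` decouples the two tracks, so that parallel reading can be
checked on each track separately. -/
theorem padPair_append_replicate_iff {A : Type*} {z : List (Option A × Option A)} {u v : List A} :
    (∃ k, z = (padPair u v).map Subtype.val ++ List.replicate k (none, none)) ↔
      IsPaddingOf (z.map Prod.fst) u ∧ IsPaddingOf (z.map Prod.snd) v := by
  constructor
  · rintro ⟨k, rfl⟩
    simp only [List.map_append, List.map_replicate, IsPaddingOf.append_replicate_iff]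
    induction u generalizing v with
    | nil =>
      cases v with
      | nil => exact ⟨⟨0, rfl⟩, ⟨0, rfl⟩⟩
      | cons b v =>
        refine ⟨⟨(b :: v).length, ?_⟩, ⟨0, ?_⟩⟩ <;>
          simp [padPair, Function.comp_def, List.replicate_succ]
    | cons a u ih =>
      cases v with
      | nil =>
        refine ⟨⟨0, ?_⟩, ⟨(a :: u).length, ?_⟩⟩ <;>
          simp [padPair, Function.comp_def, List.replicate_succ]
      | cons b v =>
        exact ⟨IsPaddingOf.cons_cons_iff.2 ⟨rfl, ih.1⟩, IsPaddingOf.cons_cons_iff.2 ⟨rfl, ih.2⟩⟩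
  · rintro ⟨h1, h2⟩
    induction z generalizing u v with
    | nil =>
      rw [IsPaddingOf.nil_iff.1 h1, IsPaddingOf.nil_iff.1 h2]
      exact ⟨0, rfl⟩
    | cons c z ih =>
      obtain ⟨c1, c2⟩ := c
      rw [List.map_cons] at h1 h2
      cases u with
      | nil =>
        obtain ⟨rfl, g1⟩ := IsPaddingOf.cons_nil_iff.1 h1
        cases v with
        | nil =>
          obtain ⟨rfl, g2⟩ := IsPaddingOf.cons_nil_iff.1 h2
          obtain ⟨k, hk⟩ := ih g1 g2
          exact ⟨k + 1, by rw [hk]; rfl⟩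
        | cons b v =>
          obtain ⟨rfl, g2⟩ := IsPaddingOf.cons_cons_iff.1 h2
          obtain ⟨k, hk⟩ := ih g1 g2
          exact ⟨k, by rw [hk]; simp [padPair]⟩
      | cons a u =>
        obtain ⟨rfl, g1⟩ := IsPaddingOf.cons_cons_iff.1 h1
        cases v with
        | nil =>
          obtain ⟨rfl, g2⟩ := IsPaddingOf.cons_nil_iff.1 h2
          obtain ⟨k, hk⟩ := ih g1 g2
          refine ⟨k, ?_⟩
          rw [hk]
          cases u <;> simp [padPair]
        | cons b v =>
          obtain ⟨rfl, g2⟩ := IsPaddingOf.cons_cons_iff.1 h2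
          obtain ⟨k, hk⟩ := ih g1 g2
          exact ⟨k, by rw [hk]; simp [padPair]⟩

theorem eq_padPair_iff {A : Type*} {w : List (PaddedAlphabet A)} {u v : List A} :
    w = padPair u v ↔
      IsPaddingOf (w.map fun c => c.1.1) u ∧ IsPaddingOf (w.map fun c => c.1.2) v := by
  have := padPair_append_replicate_iff (z := w.map Subtype.val) (u := u) (v := v)
  simp only [List.map_map, Function.comp_def] at this
  rw [← this]
  constructor
  · rintro rfl
    exact ⟨0, by simp⟩
  · rintro ⟨k, hk⟩
    -- The pair `(none, none)` is not in the padded alphabet, so no trailing padding can occur and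
    -- `k = 0`.
    cases k with
    | zero => exact Subtype.val_injective.list_map (by simpa using hk)
    | succ k =>
      have : ((none, none) : Option A × Option A) ∈ w.map Subtype.val := by
        rw [hk]
        simp
      obtain ⟨c, -, hc⟩ := List.mem_map.1 this
      exact absurd hc c.2

theorem mem_padded_paddedRel_iff {A : Type*} {L : Set (FreeSemigroup A)}
    {R : FreeSemigroup A → FreeSemigroup A → Prop} {z : List (Option A × Option A)} :
    z ∈ (paddedRel L R).padded Subtype.val (none, none) ↔ ∃ α ∈ L, ∃ β ∈ L, R α β ∧
      IsPaddingOf (z.map Prod.fst) α.toWord ∧ IsPaddingOf (z.map Prod.snd) β.toWord := by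
  constructor
  · rintro ⟨v, ⟨α, hα, β, hβ, hR, rfl⟩, h⟩
    exact ⟨α, hα, β, hβ, hR, padPair_append_replicate_iff.1 h⟩
  · rintro ⟨α, hα, β, hβ, hR, h⟩
    exact ⟨_, ⟨α, hα, β, hβ, hR, rfl⟩, padPair_append_replicate_iff.2 h⟩

theorem IsAutomatic.of_mulEquiv {S S' : Type*} [Semigroup S] [Semigroup S'] (φ : S ≃* S')
    (h : IsAutomatic S) : IsAutomatic S' := by
  obtain ⟨A, hA, hA', ψ, L, hL⟩ := h
  have key : ∀ w, FreeSemigroup.lift (φ ∘ ψ) w = φ (FreeSemigroup.lift ψ w) := by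
    intro w
    induction w using FreeSemigroup.recOnMul with
    | ih1 a => rw [FreeSemigroup.lift_of, FreeSemigroup.lift_of]; rfl
    | ih2 a w h1 h2 => rw [map_mul, h1, h2, map_mul, map_mul]
  have key' : ⇑(FreeSemigroup.lift (φ ∘ ψ)) = φ ∘ FreeSemigroup.lift ψ := funext key
  refine ⟨A, hA, hA', φ ∘ ψ, L, ?_, hL.regular, ?_, ?_, fun a => ?_⟩
  · rw [key']
    exact φ.surjective.comp hL.generates
  · rw [key', Set.image_comp, hL.image_eq, Set.image_univ, φ.surjective.range_eq]
  · simpa only [key, φ.apply_eq_iff_eq] using hL.regular_eq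
  · simpa only [key, φ.apply_eq_iff_eq] using hL.regular_mul a

/-! ### Wreath products with a finite top and their automatic structure -/

theorem wreathProduct_eq_top {S T : Type*} [Semigroup S] [Semigroup T] [Finite T] (e : S) :
    wreathProduct e T = ⊤ :=
  top_unique fun p _ => Subsemigroup.subset_closure (Set.toFinite {x : T | p.base x ≠ e})

/-- The isomorphism of unrestricted wreath products induced by an isomorphism of the acting
semigroups. -/
def UnrestrictedWreathProduct.congrTop {S T T' : Type*} [Semigroup S] [Semigroup T]
    [Semigroup T'] (ε : T ≃* T') :
    UnrestrictedWreathProduct S T ≃* UnrestrictedWreathProduct S T' where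
  toFun p := ⟨fun x => p.base (ε.symm x), ε p.top⟩
  invFun p := ⟨fun x => p.base (ε x), ε.symm p.top⟩
  left_inv p := by simp
  right_inv p := by simp
  map_mul' p q := by
    apply UnrestrictedWreathProduct.ext
    · funext x
      change p.base (ε.symm x) * q.base (ε.symm x * p.top) =
        p.base (ε.symm x) * q.base (ε.symm (x * ε p.top))
      rw [map_mul, ε.symm_apply_apply]
    · exact map_mul ε p.top q.top

namespace WreathAutomatic

variable {S T A : Type*} [Monoid S] [Monoid T]

/-- The value in `S` of a letter, the additional letter `none` standing for the identity. -/
def letter (ψ : A → S) (o : Option A) : S := o.elim 1 ψ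

/-- The value in the wreath product of a letter of the alphabet `(A ∪ {1})^T × T`. -/
def wreathLetter (ψ : A → S) (b : (T → Option A) × T) : UnrestrictedWreathProduct S T :=
  ⟨fun x => letter ψ (b.1 x), b.2⟩

open Classical in
/-- A deterministic automaton that remembers the last letter read, as long as all the letters
before it are `1`. -/
noncomputable def lastDFA (t : T) : DFA T (Option T) where
  step s c := s.bind fun d => if d = 1 then some c else none
  -- As if a letter `1` had already been read, so the first letter is unrestricted; the empty word
  -- is accepted when `t = 1`.
  start := some 1
  accept := {some t}

/-- The words whose components are paddings of words of `L`, and whose entries in `T` are all `1`,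
except for the last one, which is `t`. -/
def wordsOver (L : Set (FreeSemigroup A)) (t : T) : Language ((T → Option A) × T) :=
  {u | u.map Prod.snd ∈ (lastDFA t).accepts ∧
    ∀ x : T, ∃ α ∈ L, IsPaddingOf (u.map fun b => b.1 x) α.toWord}

/-- The language of representatives of the elements of the wreath product. -/
def wreathLanguage (T : Type*) [Monoid T] (L : Set (FreeSemigroup A)) :
    Set (FreeSemigroup ((T → Option A) × T)) :=
  {w | ∃ t, w.toWord ∈ wordsOver L t}

theorem isRegular_wordsOver [Finite T] {L : Set (FreeSemigroup A)}
    (hL : Language.IsRegular (FreeSemigroup.toWord '' L : Language A)) (t : T) :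
    (wordsOver L t).IsRegular := by
  have := Fintype.ofFinite T
  have h1 : (lastDFA t).accepts.IsRegular :=
    Language.isRegular_iff.2 ⟨Option T, inferInstance, lastDFA t, rfl⟩
  have h2 : ∀ x : T, Language.IsRegular ({u | u.map (fun b => b.1 x) ∈
      Language.padded some none (FreeSemigroup.toWord '' L : Language A)} :
        Language ((T → Option A) × T)) := fun x =>
    (hL.padded (Option.some_injective A) fun a => Option.some_ne_none a).preimage_map _
  refine ((h1.preimage_map Prod.snd).inf (Language.IsRegular.forall h2)).of_forall_mem_iff
    fun u => ?_
  refine and_congr_right fun _ => forall_congr' fun x => ?_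
  constructor
  · rintro ⟨α, hα, h⟩
    exact ⟨_, ⟨α, hα, rfl⟩, h⟩
  · rintro ⟨_, ⟨α, hα, rfl⟩, h⟩
    exact ⟨α, hα, h⟩

/-- The condition on the entries in `T` does not exclude the empty word; the component at `1` does,
since it pads a non-empty word of `L`. -/
theorem ne_nil_of_mem_wordsOver {L : Set (FreeSemigroup A)} {t : T}
    {u : List ((T → Option A) × T)} (h : u ∈ wordsOver L t) : u ≠ [] := by
  rintro rfl
  obtain ⟨α, -, hα⟩ := h.2 1
  exact List.cons_ne_nil _ _ (IsPaddingOf.nil_iff.1 hα)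

theorem isRegular_wreathLanguage [Finite T] {L : Set (FreeSemigroup A)}
    (hL : Language.IsRegular (FreeSemigroup.toWord '' L : Language A)) :
    Language.IsRegular (FreeSemigroup.toWord '' wreathLanguage T L :
      Language ((T → Option A) × T)) := by
  refine (Language.IsRegular.exists (isRegular_wordsOver (T := T) hL)).of_forall_mem_iff fun u => ?_
  constructor
  · rintro ⟨w, hw, rfl⟩
    exact hw
  · rintro ⟨t, ht⟩
    obtain ⟨w, rfl⟩ := FreeSemigroup.exists_toWord_eq (ne_nil_of_mem_wordsOver ht)
    exact ⟨w, ⟨t, ht⟩, rfl⟩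

theorem lift_wreathLetter (ψ : A → S) (w : FreeSemigroup ((T → Option A) × T)) {t : T}
    (h : w.toWord.map Prod.snd ∈ (lastDFA t).accepts) :
    FreeSemigroup.lift (wreathLetter ψ) w =
      ⟨fun x => (w.toWord.map fun b => letter ψ (b.1 x)).prod, t⟩ := by
  obtain ⟨b, l⟩ := w
  induction l using List.reverseRecOn generalizing t with
  | nil =>
    have ht : b.2 = t := by
      simpa [FreeSemigroup.toWord, DFA.mem_accepts, DFA.eval, lastDFA] using h
    rw [show (⟨b, []⟩ : FreeSemigroup ((T → Option A) × T)) = FreeSemigroup.of b from rfl,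
      FreeSemigroup.lift_of, ← ht]
    simp [wreathLetter, FreeSemigroup.toWord, FreeSemigroup.of]
  | append_singleton l c ih =>
    have hw : (⟨b, l ++ [c]⟩ : FreeSemigroup ((T → Option A) × T)) =
      ⟨b, l⟩ * FreeSemigroup.of c := rfl
    have hword : FreeSemigroup.toWord (⟨b, l ++ [c]⟩ : FreeSemigroup ((T → Option A) × T)) =
      FreeSemigroup.toWord ⟨b, l⟩ ++ [c] := rfl
    rw [hword, List.map_append, List.map_singleton, DFA.mem_accepts,
      DFA.eval_append_singleton] at h
    obtain ⟨h1, ht⟩ : (lastDFA t).eval ((FreeSemigroup.toWord ⟨b, l⟩).map Prod.snd) = some 1 ∧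
        c.2 = t := by
      generalize (lastDFA t).eval ((FreeSemigroup.toWord ⟨b, l⟩).map Prod.snd) = s at h
      cases s with
      | none => simp [lastDFA] at h
      | some d =>
        by_cases hd : d = 1
        · subst hd
          exact ⟨rfl, by simpa [lastDFA] using h⟩
        · simp [lastDFA, hd] at h
    -- The prefix has top entry `1`, so it does not shift the base of the last letter.
    rw [hw, map_mul, ih (t := 1) h1, FreeSemigroup.lift_of, ← hw, hword]
    apply UnrestrictedWreathProduct.ext
    · funext x
      change _ * letter ψ (c.1 (x * 1)) = _
      simp
    · change 1 * c.2 = t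
      rw [one_mul, ht]

theorem lift_base_eq (ψ : A → S) {w : FreeSemigroup ((T → Option A) × T)} {t x : T}
    (h : w.toWord.map Prod.snd ∈ (lastDFA t).accepts) {α : FreeSemigroup A}
    (hα : IsPaddingOf (w.toWord.map fun b => b.1 x) α.toWord) :
    (FreeSemigroup.lift (wreathLetter ψ) w).base x = FreeSemigroup.lift ψ α := by
  rw [lift_wreathLetter ψ w h, FreeSemigroup.lift_eq_prod, ← hα.prod_eq, List.map_map]
  rfl

theorem lift_top_eq (ψ : A → S) {w : FreeSemigroup ((T → Option A) × T)} {t : T}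
    (h : w.toWord.map Prod.snd ∈ (lastDFA t).accepts) :
    (FreeSemigroup.lift (wreathLetter ψ) w).top = t := by
  rw [lift_wreathLetter ψ w h]

theorem image_wreathLanguage [Finite T] {ψ : A → S} {L : Set (FreeSemigroup A)}
    (hL : FreeSemigroup.lift ψ '' L = Set.univ) :
    FreeSemigroup.lift (wreathLetter ψ) '' wreathLanguage T L = Set.univ := by
  refine Set.eq_univ_of_forall fun p => ?_
  have hx : ∀ x : T, ∃ α ∈ L, FreeSemigroup.lift ψ α = p.base x := fun x => by
    simpa using hL.ge (Set.mem_univ (p.base x))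
  choose α hα hαp using hx
  -- A common length for the representatives of all components; one further letter, trivial in every
  -- component, carries `p.top`.
  obtain ⟨n, hn⟩ := (Set.finite_range fun x : T => (α x).toWord.length).bddAbove
  let u : List ((T → Option A) × T) :=
    (List.range n).map (fun i => (fun x => (α x).toWord[i]?, 1)) ++ [(fun _ => none, p.top)]
  obtain ⟨w, hw⟩ := FreeSemigroup.exists_toWord_eq (l := u) (by simp [u])
  have hlast : w.toWord.map Prod.snd ∈ (lastDFA p.top).accepts := by
    have : ∀ k : ℕ, (lastDFA p.top).eval (List.replicate k 1) = some 1 := fun k => by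
      induction k with
      | zero => rfl
      | succ k ih =>
        rw [List.replicate_succ', DFA.eval_append_singleton, ih]
        simp [lastDFA]
    have hu : u.map Prod.snd = List.replicate n 1 ++ [p.top] := by
      simp [u, Function.comp_def]
    rw [hw, hu, DFA.mem_accepts, DFA.eval_append_singleton, this]
    simp [lastDFA]
  have hpad : ∀ x, IsPaddingOf (w.toWord.map fun b => b.1 x) (α x).toWord := fun x => by
    have hu : u.map (fun b => b.1 x) =
        (List.range n).map (fun i => (α x).toWord[i]?) ++ List.replicate 1 none := by
      simp [u, Function.comp_def]
    rw [hw, hu, IsPaddingOf.append_replicate_iff]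
    exact IsPaddingOf.map_range_getElem? (hn ⟨x, rfl⟩)
  refine ⟨w, ⟨p.top, hlast, fun x => ⟨α x, hα x, hpad x⟩⟩, ?_⟩
  apply UnrestrictedWreathProduct.ext
  · funext x
    rw [lift_base_eq ψ hlast (hpad x), hαp]
  · exact lift_top_eq ψ hlast

theorem isRegular_mul_letter {ψ : A → S} {L : Set (FreeSemigroup A)}
    (hL : IsAutomaticStructure ψ L) (o : Option A) :
    (paddedRel L fun α β =>
      FreeSemigroup.lift ψ α * letter ψ o = FreeSemigroup.lift ψ β).IsRegular := by
  cases o with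
  | none => simpa only [letter, Option.elim, mul_one] using hL.regular_eq
  | some a => simpa only [letter, Option.elim, map_mul, FreeSemigroup.lift_of] using hL.regular_mul a

/-- The projection of a pair of padded letters to a component. -/
def component (x : T) (c : PaddedAlphabet ((T → Option A) × T)) : Option A × Option A :=
  (c.1.1.bind fun b => b.1 x, c.1.2.bind fun b => b.1 x)

/-- Covers equality and right multiplication by a generator at once: `τ` is the effect on the top
entry, and `o t x` the letter multiplied onto component `x` when the top entry is `t`. -/
theorem isRegular_paddedRel [Finite T] {ψ : A → S} {L : Set (FreeSemigroup A)}
    (hL : IsAutomaticStructure ψ L) (τ : T → T) (o : T → T → Option A)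
    (R : FreeSemigroup ((T → Option A) × T) → FreeSemigroup ((T → Option A) × T) → Prop)
    (hR : ∀ α β, R α β ↔
      τ (FreeSemigroup.lift (wreathLetter ψ) α).top =
        (FreeSemigroup.lift (wreathLetter ψ) β).top ∧
      ∀ x, (FreeSemigroup.lift (wreathLetter ψ) α).base x *
          letter ψ (o (FreeSemigroup.lift (wreathLetter ψ) α).top x) =
        (FreeSemigroup.lift (wreathLetter ψ) β).base x) :
    (paddedRel (wreathLanguage T L) R).IsRegular := by
  have h1 : ∀ t : T, ((wordsOver L t).padded some none).IsRegular := fun t =>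
    (isRegular_wordsOver hL.regular t).padded (Option.some_injective _) fun a =>
      Option.some_ne_none a
  have h2 : ∀ t x : T, ((paddedRel L fun α β =>
      FreeSemigroup.lift ψ α * letter ψ (o t x) = FreeSemigroup.lift ψ β).padded
        Subtype.val (none, none)).IsRegular := fun t x =>
    (isRegular_mul_letter hL (o t x)).padded Subtype.val_injective fun a => a.2
  -- Here `t` is the top entry of the first word; fixing it makes `τ t` and the letters `o t x`
  -- constants.
  refine (Language.IsRegular.exists fun t : T =>
    (((h1 t).preimage_map fun c : PaddedAlphabet ((T → Option A) × T) => c.1.1).inf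
      ((h1 (τ t)).preimage_map fun c => c.1.2)).inf
      (Language.IsRegular.forall fun x => (h2 t x).preimage_map (component x))).of_forall_mem_iff fun w => ?_
  have hfst : ∀ (w : List (PaddedAlphabet ((T → Option A) × T))) (x : T),
      (w.map (component x)).map Prod.fst =
        (w.map fun c => c.1.1).map fun c => c.bind fun b => b.1 x := fun w x => by
    simp [component, Function.comp_def]
  have hsnd : ∀ (w : List (PaddedAlphabet ((T → Option A) × T))) (x : T),
      (w.map (component x)).map Prod.snd =
        (w.map fun c => c.1.2).map fun c => c.bind fun b => b.1 x := fun w x => by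
    simp [component, Function.comp_def]
  constructor
  · rintro ⟨α, ⟨t, hα⟩, β, ⟨s, hβ⟩, hαβ, hw⟩
    obtain ⟨hw1, hw2⟩ := eq_padPair_iff.1 hw
    obtain ⟨htop, hbase⟩ := (hR α β).1 hαβ
    rw [lift_top_eq ψ hα.1] at htop hbase
    rw [lift_top_eq ψ hβ.1] at htop
    subst htop
    refine ⟨t, ⟨⟨_, hα, hw1⟩, ⟨_, hβ, hw2⟩⟩, fun x => mem_padded_paddedRel_iff.2 ?_⟩
    obtain ⟨α', hα', hαp⟩ := hα.2 x
    obtain ⟨β', hβ', hβp⟩ := hβ.2 x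
    refine ⟨α', hα', β', hβ', ?_, ?_, ?_⟩
    · rw [← lift_base_eq ψ hα.1 hαp, hbase, lift_base_eq ψ hβ.1 hβp]
    · rw [hfst, hw1.map_bind_iff]
      exact hαp
    · rw [hsnd, hw2.map_bind_iff]
      exact hβp
  · rintro ⟨t, ⟨⟨u, hu, hw1⟩, ⟨v, hv, hw2⟩⟩, h⟩
    obtain ⟨α, rfl⟩ := FreeSemigroup.exists_toWord_eq (ne_nil_of_mem_wordsOver hu)
    obtain ⟨β, rfl⟩ := FreeSemigroup.exists_toWord_eq (ne_nil_of_mem_wordsOver hv)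
    refine ⟨α, ⟨t, hu⟩, β, ⟨τ t, hv⟩, (hR α β).2 ?_, eq_padPair_iff.2 ⟨hw1, hw2⟩⟩
    rw [lift_top_eq ψ hu.1, lift_top_eq ψ hv.1]
    refine ⟨rfl, fun x => ?_⟩
    obtain ⟨α', -, β', -, hαβ, hαp, hβp⟩ := mem_padded_paddedRel_iff.1 (h x)
    rw [hfst, IsPaddingOf.map_bind_iff hw1] at hαp
    rw [hsnd, IsPaddingOf.map_bind_iff hw2] at hβp
    rw [lift_base_eq ψ hu.1 hαp, lift_base_eq ψ hv.1 hβp, hαβ]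

theorem isAutomaticStructure [Finite T] {ψ : A → S} {L : Set (FreeSemigroup A)}
    (hL : IsAutomaticStructure ψ L) :
    IsAutomaticStructure (wreathLetter (T := T) ψ) (wreathLanguage T L) where
  generates p := by
    obtain ⟨w, -, hw⟩ := (image_wreathLanguage (T := T) hL.image_eq).ge (Set.mem_univ p)
    exact ⟨w, hw⟩
  regular := isRegular_wreathLanguage hL.regular
  image_eq := image_wreathLanguage hL.image_eq
  regular_eq := isRegular_paddedRel hL id (fun _ _ => none) _ fun α β => by
    simp [UnrestrictedWreathProduct.ext_iff, letter, funext_iff, and_comm]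
  regular_mul b := isRegular_paddedRel hL (fun t => t * b.2) (fun t x => b.1 (x * t)) _
    fun α β => by
      rw [map_mul, FreeSemigroup.lift_of, UnrestrictedWreathProduct.ext_iff, funext_iff, and_comm]
      rfl

end WreathAutomatic

theorem IsAutomatic.unrestrictedWreathProduct {S T : Type*} [Monoid S] [Monoid T] [Finite T]
    (hS : IsAutomatic S) : IsAutomatic (UnrestrictedWreathProduct S T) := by
  obtain ⟨A, hA, -, ψ, L, hL⟩ := hS
  -- The alphabet has to live in `Type`, so `T` is replaced by an isomorphic copy there.
  have : Finite (Shrink.{0} T) := Finite.of_equiv T (equivShrink.{0} T)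
  exact IsAutomatic.of_mulEquiv (UnrestrictedWreathProduct.congrTop (Shrink.mulEquiv.{0} (α := T)))
    ⟨(Shrink.{0} T → Option A) × Shrink.{0} T, inferInstance, inferInstance,
      WreathAutomatic.wreathLetter ψ, _, WreathAutomatic.isAutomaticStructure hL⟩

theorem mainTheorem6 {S T : Type*} [Monoid S] [Monoid T] [Finite T]
    (hS : IsAutomatic S) (e : S) (he : IsIdempotentElem e) :
    IsAutomatic (wreathProduct e T) := by
  rw [wreathProduct_eq_top]
  exact hS.unrestrictedWreathProduct.of_mulEquiv Subsemigroup.topEquiv.symm
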